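/- Let $(S_n)_{n\ge 0}$ be the random walk on the three-dimensional diagonal lattice started at a point $x\in\mathbb Z^3$: $S_0=x$ almost surely, and the steps $S_{n+1}-S_n$ are independent and uniformly distributed on the eight vectors $(\pm1,\pm1,\pm1)$. For $\lambda,\mu\in(0,\pi)$ with $\cos\lambda\cos\mu\ne 0$ let $\theta=\theta(\lambda,\mu)$ be a complex number with $\operatorname{Re}\theta>0$ and $\cos\lambda\,\cos\mu\,\cosh\theta=1$; such a number exists (it is not real where $\cos\lambda\cos\mu<0$). Then, for every such choice of $\theta$, the function $1/\tanh\theta$ is integrable on $(0,\pi)^2$, the number $$F=\frac1{\pi^2}\int_0^\pi\!\int_0^\pi\frac{1}{\tanh\theta}\,d\lambda\,d\mu$$ is real, $F$ is the expected number of departures of the walk from its starting point (the expected number of $n\ge0$ with $S_n=x$), and the probability that the walk returns to its starting point is $$\mathbb P(\exists\, n\ge 1:\ S_n=x)=1-\frac1F .$$ Numerically, $F\approx1.39$ and $1-\frac1F\approx0.28$, in the sense that $|F-1.39|<0.005$ and $|1-\frac1F-0.28|<0.005$. -/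

import Mathlib

open MeasureTheory ProbabilityTheory

noncomputable section

/-- `S` is (under the probability measure `P`) the random walk on the three-dimensional diagonal
lattice started at `x`: it starts at `x`, its steps are independent, and every step is uniformly
distributed on the eight vectors `(±1, ±1, ±1)`. -/
structure IsDiagonalWalk {Ω : Type*} [MeasurableSpace Ω] (P : Measure Ω)
    (S : ℕ → Ω → Fin 3 → ℤ) (x : Fin 3 → ℤ) : Prop where
  measurable : ∀ n, Measurable (S n)
  start : ∀ᵐ ω ∂P, S 0 ω = x
  indep : iIndepFun (fun (n : ℕ) (ω : Ω) => S (n + 1) ω - S n ω) P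
  step : ∀ (n : ℕ) (v : Fin 3 → ℤ),
    P {ω | S (n + 1) ω - S n ω = v} = if ∀ k, v k = 1 ∨ v k = -1 then 8⁻¹ else 0

/-- The probability that the walk `S` is at `x` at some time `n ≥ 1`. -/
def returnProbability {Ω : Type*} [MeasurableSpace Ω] (P : Measure Ω)
    (S : ℕ → Ω → Fin 3 → ℤ) (x : Fin 3 → ℤ) : ℝ :=
  P.real {ω | ∃ n : ℕ, 1 ≤ n ∧ S n ω = x}

/-- The expected number of departures from `y`. Every time `n ≥ 0` at which
the walk is at `y` is followed by a departure from `y`, so this is the expected number of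
times `n ≥ 0` with `S n = y`. -/
def expectedDepartures {Ω : Type*} [MeasurableSpace Ω] (P : Measure Ω)
    (S : ℕ → Ω → Fin 3 → ℤ) (y : Fin 3 → ℤ) : ENNReal :=
  ∫⁻ ω, ∑' n : ℕ, (if S n ω = y then 1 else 0) ∂P

/-- `θ` solves `cos lam * cos mu * cosh θ = 1` on the open square `(0, π) × (0, π)`, off the null
set where `cos lam * cos mu = 0` and there is no solution. The solution has to be complex where
`cos lam * cos mu < 0`. As `cosh` is even, `θ` and `-θ` solve together, and the one with
positive real part is meant (so that `exp (-|w| * θ)` decays in `w`). -/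
def IsAngleFunction (θ : ℝ → ℝ → ℂ) : Prop :=
  ∀ lam ∈ Set.Ioo 0 Real.pi, ∀ mu ∈ Set.Ioo 0 Real.pi, Real.cos lam * Real.cos mu ≠ 0 →
    (Real.cos lam : ℂ) * (Real.cos mu : ℂ) * Complex.cosh (θ lam mu) = 1 ∧ 0 < (θ lam mu).re

/-- `π⁻² ∫_0^π ∫_0^π (1 / tanh θ) dlam dmu`. -/
def diagonalIntegral (θ : ℝ → ℝ → ℂ) : ℂ :=
  1 / (Real.pi : ℂ) ^ 2 *
    ∫ mu in (0 : ℝ)..Real.pi, ∫ lam in (0 : ℝ)..Real.pi, 1 / Complex.tanh (θ lam mu)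

end

/-! Write u_n for `evenReturn n`. Both the integral and the walk lead to G = ∑ u_n³.

Walk: the three coordinates move as independent simple walks on ℤ, so an n-step increment has the
product law (`measureReal_increment`). The walk is thus at its start at time 2n with probability
u_n³ and never at odd times, and the expected number of visits is G. Splitting each return according
to the first one gives the renewal equation (`simpleWalkProb_cube_succ`). Summed over time it reads
G = 1 + R G, with R the return probability, so R = 1 - 1/G.

Integral: with w = cos λ cos μ, the equation w cosh θ = 1 and Re θ > 0 force 1 / tanh θ = (1 -
w²)^(-1/2), which is real (`one_div_tanh_of_mul_cosh`). The binomial series is ∑ u_n w^(2n), and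
each cosine integral over (0, π) contributes π u_n, so termwise integration gives π² G
(`lintegral_angleKernel`).

Numerics: eight explicit terms, with the tail compared to telescoping sums. -/

/-- The probability that the simple random walk on `ℤ` is back at its start at time `2 * n`. -/
noncomputable def evenReturn (n : ℕ) : ℝ := n.centralBinom / 4 ^ n

lemma evenReturn_zero : evenReturn 0 = 1 := by simp [evenReturn]

lemma evenReturn_succ (n : ℕ) :
    evenReturn (n + 1) = evenReturn n * ((2 * n + 1) / (2 * n + 2)) := by
  have h := Nat.succ_mul_centralBinom_succ n
  have h' : ((n : ℝ) + 1) * (n + 1).centralBinom = 2 * (2 * n + 1) * n.centralBinom := by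
    exact_mod_cast h
  have h1 : (n : ℝ) + 1 ≠ 0 := by positivity
  unfold evenReturn
  rw [pow_succ]
  field_simp
  linear_combination 2 * h'

lemma evenReturn_pos (n : ℕ) : 0 < evenReturn n := by
  have := n.centralBinom_pos
  unfold evenReturn
  positivity

/-- The left side is nonincreasing in n and equals 1 at n = 0. It makes the remainder in the lower
numerical bound small. -/
lemma evenReturn_sq_mul_le (n : ℕ) : evenReturn n ^ 2 * (2 * n + 1) ≤ 1 := by
  induction n with
  | zero => simp [evenReturn_zero]
  | succ n ih =>
    refine le_trans ?_ ih
    rw [evenReturn_succ]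
    have h : (((2 * n + 1) / (2 * n + 2) : ℝ)) ^ 2 * (2 * n + 3) ≤ 2 * n + 1 := by
      rw [div_pow, div_mul_eq_mul_div, div_le_iff₀ (by positivity)]
      nlinarith [(Nat.cast_nonneg n : (0 : ℝ) ≤ n)]
    push_cast
    nlinarith [mul_le_mul_of_nonneg_left h (sq_nonneg (evenReturn n))]

/-- Both sides are the rising factorial of 1/2 divided by n!. The left one is the coefficient form
in Mathlib's series for (1 - y)^(-1/2). -/
lemma evenReturn_eq_ringChoose (n : ℕ) :
    Ring.choose ((1 / 2 : ℝ) + n - 1) n = evenReturn n := by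
  have key : ∀ n : ℕ, (ascPochhammer ℕ n).smeval (1 / 2 : ℝ) = n.factorial * evenReturn n := by
    intro n
    induction n with
    | zero => simp [evenReturn_zero]
    | succ n ih =>
      rw [ascPochhammer_succ_right, Polynomial.smeval_mul, ih, evenReturn_succ, Nat.factorial_succ]
      simp only [Polynomial.smeval_add, Polynomial.smeval_X, Polynomial.smeval_natCast]
      push_cast
      have h1 : (n : ℝ) + 1 ≠ 0 := by positivity
      field_simp
      simp only [nsmul_eq_mul, mul_one]
      ring
  have h := Ring.factorial_nsmul_multichoose_eq_ascPochhammer (1 / 2 : ℝ) n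
  rw [key, nsmul_eq_mul] at h
  rw [Ring.choose]
  have hn : (n.factorial : ℝ) ≠ 0 := by positivity
  rw [← mul_left_cancel₀ hn h]
  congr 1
  ring

lemma hasSum_evenReturn_mul_pow {y : ℝ} (h0 : 0 ≤ y) (h1 : y < 1) :
    HasSum (fun n => evenReturn n * y ^ n) (1 / √(1 - y)) := by
  have h := (Real.one_div_one_sub_rpow_hasFPowerSeriesOnBall_zero (1 / 2)).hasSum
    (y := y) (by simpa [enorm_eq_nnnorm, abs_of_nonneg h0, ← NNReal.coe_lt_coe] using h1)
  rw [Real.sqrt_eq_rpow]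
  simpa [FormalMultilinearSeries.ofScalars_apply_eq, ← evenReturn_eq_ringChoose, mul_comm] using h

lemma integral_cos_pow_even (n : ℕ) :
    ∫ t in (0 : ℝ)..Real.pi, Real.cos t ^ (2 * n) = Real.pi * evenReturn n := by
  induction n with
  | zero => simp [evenReturn_zero]
  | succ n ih =>
    rw [show 2 * (n + 1) = 2 * n + 2 by ring, integral_cos_pow, ih, evenReturn_succ]
    simp
    ring

/-! ### Numerical bounds for the sum of the cubes -/

/-- As u_n³ decays like n^(-3/2), its tail is close to (2n + c) u_n³. The choice c = 1 cancels the
1/n error and leaves a lower bound; any c > 1 gives an upper bound for large n, and c = 21/20 works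
from n = 8. -/
lemma evenReturn_cube_telescope_lower (n : ℕ) :
    (2 * n + 1) * evenReturn n ^ 3 - (2 * (n + 1 : ℕ) + 1) * evenReturn (n + 1) ^ 3
      ≤ evenReturn n ^ 3 := by
  have h : (2 * n : ℝ) ≤ (2 * n + 3) * ((2 * n + 1) / (2 * n + 2)) ^ 3 := by
    rw [div_pow, mul_div_assoc', le_div_iff₀ (by positivity)]
    have : (0 : ℝ) ≤ n := Nat.cast_nonneg n
    nlinarith [pow_nonneg this 2, pow_nonneg this 3]
  have h3 := pow_pos (evenReturn_pos n) 3
  rw [evenReturn_succ, mul_pow]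
  push_cast
  nlinarith [mul_le_mul_of_nonneg_left h h3.le]

lemma evenReturn_cube_telescope_upper {n : ℕ} (hn : 8 ≤ n) :
    evenReturn n ^ 3 ≤
      (2 * n + 21 / 20) * evenReturn n ^ 3 -
        (2 * (n + 1 : ℕ) + 21 / 20) * evenReturn (n + 1) ^ 3 := by
  have h : (2 * n + 61 / 20 : ℝ) * ((2 * n + 1) / (2 * n + 2)) ^ 3 ≤ 2 * n + 1 / 20 := by
    obtain ⟨k, rfl⟩ := Nat.exists_eq_add_of_le hn
    rw [div_pow, mul_div_assoc', div_le_iff₀ (by positivity)]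
    have : (0 : ℝ) ≤ k := Nat.cast_nonneg k
    push_cast
    nlinarith [pow_nonneg this 2, pow_nonneg this 3]
  have h3 := pow_pos (evenReturn_pos n) 3
  rw [evenReturn_succ, mul_pow]
  push_cast
  nlinarith [mul_le_mul_of_nonneg_left h h3.le]

lemma sum_evenReturn_cube_le (m : ℕ) :
    ∑ n ∈ Finset.range (m + 8), evenReturn n ^ 3 ≤
      ∑ n ∈ Finset.range 8, evenReturn n ^ 3 + (2 * 8 + 21 / 20) * evenReturn 8 ^ 3 := by
  suffices h : ∑ n ∈ Finset.range (m + 8), evenReturn n ^ 3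
      + (2 * (m + 8 : ℕ) + 21 / 20) * evenReturn (m + 8) ^ 3 ≤
      ∑ n ∈ Finset.range 8, evenReturn n ^ 3 + (2 * 8 + 21 / 20) * evenReturn 8 ^ 3 by
    have := evenReturn_pos (m + 8)
    have : 0 ≤ (2 * (m + 8 : ℕ) + 21 / 20) * evenReturn (m + 8) ^ 3 := by positivity
    linarith
  induction m with
  | zero => norm_num
  | succ m ih =>
    rw [show m + 1 + 8 = m + 8 + 1 by ring, Finset.sum_range_succ]
    have := evenReturn_cube_telescope_upper (n := m + 8) (by omega)
    linarith

lemma le_sum_evenReturn_cube (m : ℕ) :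
    ∑ n ∈ Finset.range 8, evenReturn n ^ 3 + (2 * 8 + 1) * evenReturn 8 ^ 3 ≤
    ∑ n ∈ Finset.range (m + 8), evenReturn n ^ 3
      + (2 * (m + 8 : ℕ) + 1) * evenReturn (m + 8) ^ 3 := by
  induction m with
  | zero => norm_num
  | succ m ih =>
    rw [show m + 1 + 8 = m + 8 + 1 by ring, Finset.sum_range_succ _ (m + 8)]
    have := evenReturn_cube_telescope_lower (m + 8)
    linarith

lemma summable_evenReturn_cube : Summable fun n => evenReturn n ^ 3 := by
  refine summable_of_sum_range_le (c := ∑ n ∈ Finset.range 8, evenReturn n ^ 3 +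
    (2 * 8 + 21 / 20) * evenReturn 8 ^ 3) (fun n => (pow_pos (evenReturn_pos n) 3).le) (fun m => ?_)
  refine le_trans ?_ (sum_evenReturn_cube_le m)
  exact Finset.sum_le_sum_of_subset_of_nonneg (Finset.range_mono (by omega))
    (fun n _ _ => (pow_pos (evenReturn_pos n) 3).le)

lemma tsum_evenReturn_cube_lt : ∑' n, evenReturn n ^ 3 < 1.395 := by
  have h : ∑' n, evenReturn n ^ 3 ≤
      ∑ n ∈ Finset.range 8, evenReturn n ^ 3 + (2 * 8 + 21 / 20) * evenReturn 8 ^ 3 := by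
    refine Real.tsum_le_of_sum_range_le (fun n => (pow_pos (evenReturn_pos n) 3).le) (fun m => ?_)
    refine le_trans ?_ (sum_evenReturn_cube_le m)
    exact Finset.sum_le_sum_of_subset_of_nonneg (Finset.range_mono (by omega))
      (fun n _ _ => (pow_pos (evenReturn_pos n) 3).le)
  refine h.trans_lt ?_
  simp only [Finset.sum_range_succ, evenReturn_succ, evenReturn_zero]
  norm_num

lemma lt_tsum_evenReturn_cube : 1.385 < ∑' n, evenReturn n ^ 3 := by
  -- The existential keeps `M` opaque, so that no sum over a million terms is evaluated. This size
  -- gives u < 0.001, hence a remainder below 0.001 = 1.386 - 1.385.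
  obtain ⟨M, hM⟩ : ∃ M : ℕ, 1000000 ≤ M := ⟨_, le_rfl⟩
  have hM' : (1000000 : ℝ) ≤ M := by exact_mod_cast hM
  have h1 := le_sum_evenReturn_cube M
  have h2 := summable_evenReturn_cube.sum_le_tsum (Finset.range (M + 8))
    (fun n _ => (pow_pos (evenReturn_pos n) 3).le)
  have h3 := evenReturn_sq_mul_le (M + 8)
  have h4 := evenReturn_pos (M + 8)
  have h5 : evenReturn (M + 8) < 0.001 := by
    by_contra! hc
    push_cast at h3
    nlinarith
  have h6 : (2 * ((M + 8 : ℕ) : ℝ) + 1) * evenReturn (M + 8) ^ 3 < 0.001 := by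
    have := mul_le_mul_of_nonneg_left h3 h4.le
    linarith
  have h7 : (1.386 : ℝ) <
      ∑ n ∈ Finset.range 8, evenReturn n ^ 3 + (2 * 8 + 1) * evenReturn 8 ^ 3 := by
    simp only [Finset.sum_range_succ, evenReturn_succ, evenReturn_zero]
    norm_num
  linarith

/-! ### The integral of 1 / tanh θ. -/

/-- For θ = u + iv the imaginary part of the equation is w sinh u sin v = 0, so sin v = 0. The sign
cos v = ±1 cancels in the quotient, leaving tanh θ = tanh u > 0, also when w < 0. -/
lemma one_div_tanh_of_mul_cosh {w : ℝ} {θ : ℂ} (h : (w : ℂ) * Complex.cosh θ = 1)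
    (hθ : 0 < θ.re) : 1 / Complex.tanh θ = ((1 / √(1 - w ^ 2) : ℝ) : ℂ) := by
  obtain ⟨u, v⟩ := θ
  simp only at hθ
  have hsu : 0 < Real.sinh u := Real.sinh_pos_iff.2 hθ
  have hcu : 0 < Real.cosh u := Real.cosh_pos u
  have hc : Complex.cosh ⟨u, v⟩ =
      (Real.cosh u * Real.cos v : ℝ) + (Real.sinh u * Real.sin v : ℝ) * Complex.I := by
    rw [Complex.mk_eq_add_mul_I, Complex.cosh_add, Complex.cosh_mul_I, Complex.sinh_mul_I]
    push_cast
    ring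
  have hs : Complex.sinh ⟨u, v⟩ =
      (Real.sinh u * Real.cos v : ℝ) + (Real.cosh u * Real.sin v : ℝ) * Complex.I := by
    rw [Complex.mk_eq_add_mul_I, Complex.sinh_add, Complex.cosh_mul_I, Complex.sinh_mul_I]
    push_cast
    ring
  rw [hc] at h
  have hre : w * (Real.cosh u * Real.cos v) = 1 := by
    simpa only [Complex.re_ofReal_mul, Complex.add_re, Complex.ofReal_re, Complex.I_re, mul_zero,
      add_zero, Complex.one_re] using congrArg Complex.re h
  have him : w * (Real.sinh u * Real.sin v) = 0 := by
    simpa only [Complex.im_ofReal_mul, Complex.add_im, Complex.ofReal_im, Complex.I_im, mul_one,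
      zero_add, Complex.one_im] using congrArg Complex.im h
  have hw : w ≠ 0 := by rintro rfl; simp at hre
  have hsin : Real.sin v = 0 := by
    rcases mul_eq_zero.1 him with h0 | h0
    · exact absurd h0 hw
    · exact (mul_eq_zero.1 h0).resolve_left hsu.ne'
  have hcos : Real.cos v ≠ 0 := by intro h0; simp [h0] at hre
  have hcos2 : Real.cos v ^ 2 = 1 := by have := Real.sin_sq_add_cos_sq v; rw [hsin] at this; linarith
  have ht : Complex.tanh ⟨u, v⟩ = ((Real.sinh u / Real.cosh u : ℝ) : ℂ) := by
    rw [Complex.tanh, hc, hs, hsin]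
    have : (Real.cos v : ℂ) ≠ 0 := by exact_mod_cast hcos
    push_cast at *
    simp only [mul_zero, zero_mul, add_zero]
    exact mul_div_mul_right _ _ this
  have hsq : (Real.sinh u / Real.cosh u) ^ 2 = 1 - w ^ 2 := by
    have h1 := Real.cosh_sq u
    have h2 : w ^ 2 * Real.cosh u ^ 2 = 1 := by
      calc _ = (w * (Real.cosh u * Real.cos v)) ^ 2 := by rw [mul_pow, mul_pow, hcos2]; ring
        _ = 1 := by rw [hre]; norm_num
    rw [div_pow, div_eq_iff (by positivity)]
    linarith
  rw [ht, ← hsq, Real.sqrt_sq (by positivity)]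
  push_cast
  rfl

/-- A purely imaginary solution would make 1/w a real cosine, contradicting |w| < 1. Since cosh is
even, the sign of the real part can then be chosen. -/
lemma exists_mul_cosh_eq_one {w : ℝ} (h0 : w ≠ 0) (h1 : |w| < 1) :
    ∃ θ : ℂ, (w : ℂ) * Complex.cosh θ = 1 ∧ 0 < θ.re := by
  have hw : (w : ℂ) ≠ 0 := by exact_mod_cast h0
  obtain ⟨z, hz⟩ := Complex.cos_surjective (w : ℂ)⁻¹
  have key : ∀ θ : ℂ, Complex.cosh θ = (w : ℂ)⁻¹ → θ.re ≠ 0 := by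
    intro θ hθ hre
    have h : θ = (θ.im : ℂ) * Complex.I := by
      apply Complex.ext <;> simp [hre]
    rw [h, Complex.cosh_mul_I] at hθ
    have h2 : Real.cos θ.im = w⁻¹ := by exact_mod_cast hθ
    have h3 := Real.abs_cos_le_one θ.im
    rw [h2, abs_inv] at h3
    exact absurd h3 (not_le.2 ((one_lt_inv₀ (abs_pos.2 h0)).2 h1))
  have hc : Complex.cosh (z * Complex.I) = (w : ℂ)⁻¹ := by rw [Complex.cosh_mul_I, hz]
  rcases lt_or_gt_of_ne (key _ hc) with h | h
  · exact ⟨-(z * Complex.I), by rw [Complex.cosh_neg, hc, mul_inv_cancel₀ hw],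
      by rw [Complex.neg_re]; linarith⟩
  · exact ⟨z * Complex.I, by rw [hc, mul_inv_cancel₀ hw], h⟩

lemma abs_cos_lt_one_of_mem_Ioo {t : ℝ} (ht : t ∈ Set.Ioo 0 Real.pi) : |Real.cos t| < 1 := by
  have h1 := Real.sin_pos_of_mem_Ioo ht
  have h2 := Real.sin_sq_add_cos_sq t
  rw [← sq_lt_one_iff_abs_lt_one]
  nlinarith

lemma abs_cos_mul_cos_lt_one {s t : ℝ} (hs : s ∈ Set.Ioo 0 Real.pi) (ht : t ∈ Set.Ioo 0 Real.pi) :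
    |Real.cos s * Real.cos t| < 1 := by
  rw [abs_mul]
  exact mul_lt_one_of_nonneg_of_lt_one_left (abs_nonneg _) (abs_cos_lt_one_of_mem_Ioo hs)
    (abs_cos_lt_one_of_mem_Ioo ht).le

lemma exists_isAngleFunction : ∃ θ : ℝ → ℝ → ℂ, IsAngleFunction θ := by
  have h : ∀ lam mu : ℝ, ∃ z : ℂ, lam ∈ Set.Ioo 0 Real.pi → mu ∈ Set.Ioo 0 Real.pi →
      Real.cos lam * Real.cos mu ≠ 0 →
      (Real.cos lam : ℂ) * (Real.cos mu : ℂ) * Complex.cosh z = 1 ∧ 0 < z.re := by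
    intro lam mu
    by_cases hc : lam ∈ Set.Ioo 0 Real.pi ∧ mu ∈ Set.Ioo 0 Real.pi ∧
        Real.cos lam * Real.cos mu ≠ 0
    · obtain ⟨z, hz⟩ := exists_mul_cosh_eq_one hc.2.2 (abs_cos_mul_cos_lt_one hc.1 hc.2.1)
      exact ⟨z, fun _ _ _ => by simpa using hz⟩
    · exact ⟨0, fun h1 h2 h3 => absurd ⟨h1, h2, h3⟩ hc⟩
  choose θ hθ using h
  exact ⟨θ, fun lam h1 mu h2 h3 => hθ lam mu h1 h2 h3⟩

/-- The real value of `1 / tanh θ` on the open square. -/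
noncomputable def angleKernel (z : ℝ × ℝ) : ℝ := 1 / √(1 - (Real.cos z.1 * Real.cos z.2) ^ 2)

lemma measurable_angleKernel : Measurable angleKernel := by
  unfold angleKernel
  fun_prop

lemma angleKernel_nonneg (z : ℝ × ℝ) : 0 ≤ angleKernel z := by
  unfold angleKernel
  positivity

lemma cos_ne_zero_of_mem_Ioo {t : ℝ} (ht : t ∈ Set.Ioo 0 Real.pi) (h : t ≠ Real.pi / 2) :
    Real.cos t ≠ 0 := by
  intro h0
  apply h
  refine Real.injOn_cos ⟨ht.1.le, ht.2.le⟩ ⟨by positivity, by linarith [Real.pi_pos]⟩ ?_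
  rw [h0, Real.cos_pi_div_two]

lemma one_div_tanh_ae_eq {θ : ℝ → ℝ → ℂ} (hθ : IsAngleFunction θ) :
    (fun z : ℝ × ℝ => 1 / Complex.tanh (θ z.1 z.2))
      =ᵐ[volume.restrict (Set.Ioo 0 Real.pi ×ˢ Set.Ioo 0 Real.pi)]
      fun z => (angleKernel z : ℂ) := by
  -- `IsAngleFunction` says nothing about θ on the two lines where a cosine vanishes; they are null
  -- sets.
  have h1 : ∀ᵐ z : ℝ × ℝ, z.1 ≠ Real.pi / 2 :=
    (Measure.quasiMeasurePreserving_fst (μ := (volume : Measure ℝ))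
      (ν := (volume : Measure ℝ))).ae (Measure.ae_ne volume _)
  have h2 : ∀ᵐ z : ℝ × ℝ, z.2 ≠ Real.pi / 2 :=
    (Measure.quasiMeasurePreserving_snd (μ := (volume : Measure ℝ))
      (ν := (volume : Measure ℝ))).ae (Measure.ae_ne volume _)
  filter_upwards [ae_restrict_mem (measurableSet_Ioo.prod measurableSet_Ioo),
    ae_restrict_of_ae h1, ae_restrict_of_ae h2] with z hz hz1 hz2
  obtain ⟨h3, h4⟩ := hθ z.1 hz.1 z.2 hz.2 (mul_ne_zero (cos_ne_zero_of_mem_Ioo hz.1 hz1)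
    (cos_ne_zero_of_mem_Ioo hz.2 hz2))
  exact one_div_tanh_of_mul_cosh (by push_cast at h3 ⊢; exact h3) h4

lemma lintegral_ofReal_cos_pow_even (n : ℕ) :
    ∫⁻ t in Set.Ioo 0 Real.pi, ENNReal.ofReal (Real.cos t ^ (2 * n)) =
      ENNReal.ofReal (Real.pi * evenReturn n) := by
  rw [← integral_cos_pow_even, intervalIntegral.integral_of_le Real.pi_pos.le,
    integral_Ioc_eq_integral_Ioo,
    ofReal_integral_eq_lintegral_ofReal]
  · exact ((by fun_prop : Continuous fun t : ℝ => Real.cos t ^ (2 * n)).integrableOn_Icc).mono_set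
      Set.Ioo_subset_Icc_self
  · exact Filter.Eventually.of_forall fun t => (even_two_mul n).pow_nonneg _

/-- The kernel is unbounded near the corners of the square. All terms of the series are nonnegative,
so Tonelli in `ENNReal` yields integrability together with the value. -/
lemma lintegral_angleKernel :
    ∫⁻ z in Set.Ioo 0 Real.pi ×ˢ Set.Ioo 0 Real.pi, ENNReal.ofReal (angleKernel z) =
      ENNReal.ofReal (Real.pi ^ 2 * ∑' n, evenReturn n ^ 3) := by
  have hser : ∀ z ∈ Set.Ioo 0 Real.pi ×ˢ Set.Ioo 0 Real.pi, ENNReal.ofReal (angleKernel z) =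
      ∑' n, ENNReal.ofReal (evenReturn n) *
        (ENNReal.ofReal (Real.cos z.1 ^ (2 * n)) * ENNReal.ofReal (Real.cos z.2 ^ (2 * n))) := by
    intro z hz
    have h1 := abs_cos_mul_cos_lt_one hz.1 hz.2
    have h2 := hasSum_evenReturn_mul_pow (sq_nonneg (Real.cos z.1 * Real.cos z.2))
      ((sq_lt_one_iff_abs_lt_one _).2 h1)
    rw [angleKernel, ← h2.tsum_eq, ENNReal.ofReal_tsum_of_nonneg _ h2.summable]
    · congr with n
      rw [← ENNReal.ofReal_mul ((even_two_mul n).pow_nonneg _),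
        ← ENNReal.ofReal_mul (evenReturn_pos n).le, ← pow_mul, mul_pow]
    · intro n
      have := evenReturn_pos n
      positivity
  rw [setLIntegral_congr_fun (measurableSet_Ioo.prod measurableSet_Ioo) hser,
    lintegral_tsum (fun n => by fun_prop), ← tsum_mul_left,
    ENNReal.ofReal_tsum_of_nonneg (fun n => by have := evenReturn_pos n; positivity)
      (summable_evenReturn_cube.mul_left _)]
  congr with n
  rw [lintegral_const_mul _ (by fun_prop), Measure.volume_eq_prod, ← Measure.prod_restrict,
    lintegral_prod_mul (f := fun t => ENNReal.ofReal (Real.cos t ^ (2 * n)))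
      (g := fun t => ENNReal.ofReal (Real.cos t ^ (2 * n))) (by fun_prop) (by fun_prop), lintegral_ofReal_cos_pow_even,
    ← ENNReal.ofReal_mul (by have := evenReturn_pos n; positivity),
    ← ENNReal.ofReal_mul (evenReturn_pos n).le]
  congr 1
  ring

lemma integrableOn_angleKernel :
    IntegrableOn angleKernel (Set.Ioo 0 Real.pi ×ˢ Set.Ioo 0 Real.pi) := by
  refine ⟨measurable_angleKernel.aestronglyMeasurable, ?_⟩
  rw [hasFiniteIntegral_iff_ofReal (Filter.Eventually.of_forall angleKernel_nonneg),
    lintegral_angleKernel]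
  exact ENNReal.ofReal_lt_top

lemma integral_angleKernel :
    ∫ z in Set.Ioo 0 Real.pi ×ˢ Set.Ioo 0 Real.pi, angleKernel z =
      Real.pi ^ 2 * ∑' n, evenReturn n ^ 3 := by
  rw [integral_eq_lintegral_of_nonneg_ae (Filter.Eventually.of_forall angleKernel_nonneg)
    measurable_angleKernel.aestronglyMeasurable, lintegral_angleKernel, ENNReal.toReal_ofReal]
  exact mul_nonneg (sq_nonneg _) (tsum_nonneg fun n => (pow_pos (evenReturn_pos n) 3).le)

lemma integrableOn_one_div_tanh {θ : ℝ → ℝ → ℂ} (hθ : IsAngleFunction θ) :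
    IntegrableOn (fun z : ℝ × ℝ => 1 / Complex.tanh (θ z.1 z.2))
        (Set.Ioo 0 Real.pi ×ˢ Set.Ioo 0 Real.pi) :=
  (Integrable.ofReal integrableOn_angleKernel).congr (one_div_tanh_ae_eq hθ).symm

lemma diagonalIntegral_eq {θ : ℝ → ℝ → ℂ} (hθ : IsAngleFunction θ) :
    diagonalIntegral θ = ((∑' n, evenReturn n ^ 3 : ℝ) : ℂ) := by
  have h : ∫ mu in (0 : ℝ)..Real.pi, ∫ lam in (0 : ℝ)..Real.pi, 1 / Complex.tanh (θ lam mu) =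
      ∫ z in Set.Ioo 0 Real.pi ×ˢ Set.Ioo 0 Real.pi, 1 / Complex.tanh (θ z.1 z.2) := by
    have hi := integrableOn_one_div_tanh hθ
    rw [IntegrableOn, Measure.volume_eq_prod, ← Measure.prod_restrict] at hi
    rw [Measure.volume_eq_prod, ← Measure.prod_restrict, integral_prod_symm _ hi,
      intervalIntegral.integral_of_le Real.pi_pos.le, integral_Ioc_eq_integral_Ioo]
    congr with mu
    rw [intervalIntegral.integral_of_le Real.pi_pos.le, integral_Ioc_eq_integral_Ioo]
  rw [diagonalIntegral, h, integral_congr_ae (one_div_tanh_ae_eq hθ), integral_complex_ofReal,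
    integral_angleKernel]
  have : (Real.pi : ℂ) ≠ 0 := by exact_mod_cast Real.pi_ne_zero
  push_cast
  field_simp

/-! ### Transition probabilities and the product structure of the steps. -/

/-- The transition probabilities of the simple random walk on `ℤ`. -/
noncomputable def simpleWalkProb : ℕ → ℤ → ℝ
  | 0, j => if j = 0 then 1 else 0
  | n + 1, j => (simpleWalkProb n (j - 1) + simpleWalkProb n (j + 1)) / 2

lemma simpleWalkProb_eq_zero_of_lt {n : ℕ} {j : ℤ} (h : j < -n) : simpleWalkProb n j = 0 := by
  induction n generalizing j with
  | zero => simp [simpleWalkProb]; simp at h; omega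
  | succ n ih =>
    push_cast at h
    rw [simpleWalkProb, ih (by omega), ih (by omega)]
    simp

lemma simpleWalkProb_eq_zero_of_odd {n : ℕ} {j : ℤ} (h : Odd (n + j)) :
    simpleWalkProb n j = 0 := by
  induction n generalizing j with
  | zero =>
    have : j ≠ 0 := by rintro rfl; simp at h
    simp [simpleWalkProb, this]
  | succ n ih =>
    push_cast at h
    rw [simpleWalkProb, ih (by rw [Int.odd_iff] at *; omega), ih (by rw [Int.odd_iff] at *; omega)]
    simp

lemma simpleWalkProb_two_mul_sub (n k : ℕ) :
    simpleWalkProb n (2 * k - n) = n.choose k / 2 ^ n := by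
  induction n generalizing k with
  | zero => cases k <;> simp [simpleWalkProb]; omega
  | succ n ih =>
    rw [simpleWalkProb, show (2 * k - (n + 1 : ℕ) + 1 : ℤ) = 2 * k - n by push_cast; ring, ih]
    cases k with
    | zero =>
      rw [simpleWalkProb_eq_zero_of_lt (by push_cast; omega)]
      simp [pow_succ]
      ring
    | succ k =>
      rw [show (2 * (k + 1 : ℕ) - (n + 1 : ℕ) - 1 : ℤ) = 2 * k - n by push_cast; ring, ih,
        Nat.choose_succ_succ]
      push_cast
      field_simp
      ring

lemma simpleWalkProb_two_mul (n : ℕ) : simpleWalkProb (2 * n) 0 = evenReturn n := by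
  have h := simpleWalkProb_two_mul_sub (2 * n) n
  rw [evenReturn, Nat.centralBinom]
  rw [pow_mul] at h
  norm_num at h
  exact h

lemma simpleWalkProb_two_mul_add_one (n : ℕ) : simpleWalkProb (2 * n + 1) 0 = 0 :=
  simpleWalkProb_eq_zero_of_odd (by simp)

lemma hasSum_simpleWalkProb_cube :
    HasSum (fun n => simpleWalkProb n 0 ^ 3) (∑' n, evenReturn n ^ 3) := by
  rw [← add_zero (∑' n, evenReturn n ^ 3)]
  refine HasSum.even_add_odd ?_ ?_
  · simpa only [simpleWalkProb_two_mul] using summable_evenReturn_cube.hasSum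
  · simp only [simpleWalkProb_two_mul_add_one]
    simp

/-- The eight steps `(±1, ±1, ±1)`. -/
def diagonalSteps : Finset (Fin 3 → ℤ) := Fintype.piFinset fun _ => {1, -1}

lemma mem_diagonalSteps {v : Fin 3 → ℤ} : v ∈ diagonalSteps ↔ ∀ k, v k = 1 ∨ v k = -1 := by
  simp [diagonalSteps]

/-- The step set is a product, so the sum factors over coordinates, and 1/8 supplies a factor 1/2 to
each. -/
lemma sum_diagonalSteps_prod_simpleWalkProb (n : ℕ) (v : Fin 3 → ℤ) :
    ∑ d ∈ diagonalSteps, (∏ k, simpleWalkProb n (v k - d k)) * 8⁻¹ =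
      ∏ k, simpleWalkProb (n + 1) (v k) := by
  rw [← Finset.sum_mul, diagonalSteps,
    ← Finset.prod_univ_sum (fun _ => ({1, -1} : Finset ℤ))
      (fun (k : Fin 3) (e : ℤ) => simpleWalkProb n (v k - e))]
  have h : ∀ k : Fin 3, ∑ e ∈ ({1, -1} : Finset ℤ), simpleWalkProb n (v k - e) =
      2 * simpleWalkProb (n + 1) (v k) := by
    intro k
    rw [Finset.sum_pair (by norm_num), simpleWalkProb, sub_neg_eq_add]
    ring
  simp only [h, Finset.prod_mul_distrib, Finset.prod_const, Finset.card_univ, Fintype.card_fin]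
  ring

lemma sum_Ico_walk_steps {Ω : Type*} (S : ℕ → Ω → Fin 3 → ℤ) (m n : ℕ) (ω : Ω) :
    ∑ i ∈ Finset.Ico m (m + n), (S (i + 1) ω - S i ω) = S (m + n) ω - S m ω := by
  induction n with
  | zero => simp
  | succ n ih =>
    rw [← add_assoc, Finset.sum_Ico_succ_top (by omega), ih]
    abel

/-! ### First returns, renewal and the expected number of visits. -/

/-- The event that the walk is back at its start for the first time at time `k + 1`. -/
def firstReturn {Ω : Type*} (S : ℕ → Ω → Fin 3 → ℤ) (k : ℕ) : Set Ω :=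
  {ω | (∀ i, 1 ≤ i → i < k + 1 → S i ω - S 0 ω ≠ 0) ∧ S (k + 1) ω - S 0 ω = 0}

lemma pairwise_disjoint_firstReturn {Ω : Type*} (S : ℕ → Ω → Fin 3 → ℤ) :
    Pairwise (Function.onFun Disjoint (firstReturn S)) := by
  have h : ∀ i j, i < j → Disjoint (firstReturn S i) (firstReturn S j) := fun i j hij =>
    Set.disjoint_left.2 fun ω h1 h2 => h2.1 (i + 1) (by omega) (by omega) h1.2
  intro i j hij
  rcases lt_or_gt_of_ne hij with h1 | h1
  · exact h i j h1
  · exact (h j i h1).symm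

lemma exists_le_mem_firstReturn {Ω : Type*} {S : ℕ → Ω → Fin 3 → ℤ} {n : ℕ} {ω : Ω}
    (h : S (n + 1) ω - S 0 ω = 0) : ∃ k ≤ n, ω ∈ firstReturn S k := by
  classical
  have hex : ∃ k, S (k + 1) ω - S 0 ω = 0 := ⟨n, h⟩
  refine ⟨Nat.find hex, Nat.find_min' hex h, ?_, Nat.find_spec hex⟩
  intro i h1 h2
  obtain ⟨i, rfl⟩ := Nat.exists_eq_add_of_le' h1
  exact Nat.find_min hex (by omega)

namespace IsDiagonalWalk

variable {Ω : Type*} [MeasurableSpace Ω] {P : Measure Ω}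
  {S : ℕ → Ω → Fin 3 → ℤ} {x : Fin 3 → ℤ}

lemma measurable_step (hS : IsDiagonalWalk P S x) (n : ℕ) :
    Measurable fun ω => S (n + 1) ω - S n ω :=
  (hS.measurable _).sub (hS.measurable _)

lemma ae_step_mem (hS : IsDiagonalWalk P S x) (n : ℕ) :
    ∀ᵐ ω ∂P, S (n + 1) ω - S n ω ∈ diagonalSteps := by
  have h : ∀ v : Fin 3 → ℤ, ∀ᵐ ω ∂P, v ∉ diagonalSteps → S (n + 1) ω - S n ω ≠ v := by
    intro v
    by_cases hv : v ∈ diagonalSteps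
    · simp [hv]
    · have h0 := hS.step n v
      rw [if_neg (by rwa [mem_diagonalSteps] at hv)] at h0
      rw [ae_iff]
      simpa [hv] using h0
  filter_upwards [ae_all_iff.2 h] with ω hω
  by_contra hc
  exact hω _ hc rfl

/-- Induction by conditioning on the last step, which is independent of the sum of the earlier ones.
A general starting time `m` is needed to restart the walk after its first return. -/
lemma measureReal_increment [IsProbabilityMeasure P] (hS : IsDiagonalWalk P S x) (m n : ℕ)
    (v : Fin 3 → ℤ) :
    P.real {ω | S (m + n) ω - S m ω = v} = ∏ k, simpleWalkProb n (v k) := by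
  induction n generalizing v with
  | zero =>
    by_cases hv : v = 0
    · subst hv
      simp [simpleWalkProb]
    · obtain ⟨k, hk⟩ := Function.ne_iff.1 hv
      rw [Finset.prod_eq_zero (Finset.mem_univ k) (by simpa [simpleWalkProb] using hk)]
      simp [Ne.symm hv]
  | succ n ih =>
    have hind := hS.indep.indepFun_finsetSum_of_notMem hS.measurable_step
      (s := Finset.Ico m (m + n)) (i := m + n) (by simp)
    have hsum : (∑ i ∈ Finset.Ico m (m + n), fun ω => S (i + 1) ω - S i ω) =
        fun ω => S (m + n) ω - S m ω := by
      ext1 ω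
      rw [Finset.sum_apply, sum_Ico_walk_steps]
    rw [hsum] at hind
    have hae : {ω | S (m + (n + 1)) ω - S m ω = v} =ᵐ[P]
        ⋃ d ∈ diagonalSteps, ({ω | S (m + n) ω - S m ω = v - d} ∩
          {ω | S (m + n + 1) ω - S (m + n) ω = d} : Set Ω) := by
      filter_upwards [hS.ae_step_mem (m + n)] with ω hω
      apply propext
      change S (m + n + 1) ω - S m ω = v ↔ ω ∈ ⋃ d ∈ diagonalSteps, _
      simp only [Set.mem_iUnion, Set.mem_inter_iff, Set.mem_ofPred_eq, exists_prop]
      constructor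
      · intro h
        refine ⟨_, hω, ?_, rfl⟩
        rw [← h]
        abel
      · rintro ⟨d, -, h1, h2⟩
        rw [← sub_add_sub_cancel _ (S (m + n) ω), h1, h2]
        abel
    have hm1 : ∀ d, MeasurableSet {ω | S (m + n) ω - S m ω = d} := fun d =>
      ((hS.measurable _).sub (hS.measurable _)) (measurableSet_singleton d)
    have hm2 : ∀ d, MeasurableSet {ω | S (m + n + 1) ω - S (m + n) ω = d} := fun d =>
      hS.measurable_step (m + n) (measurableSet_singleton d)
    rw [measureReal_congr hae, measureReal_biUnion_finset _ (fun d _ => (hm1 _).inter (hm2 _)),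
      ← sum_diagonalSteps_prod_simpleWalkProb]
    · refine Finset.sum_congr rfl fun d hd => ?_
      have h := hind.measure_inter_preimage_eq_mul {v - d} {d} (measurableSet_singleton _)
        (measurableSet_singleton _)
      have h8 := hS.step (m + n) d
      rw [if_pos (mem_diagonalSteps.1 hd)] at h8
      have h' : P ({ω | S (m + n) ω - S m ω = v - d} ∩
          {ω | S (m + n + 1) ω - S (m + n) ω = d}) =
          P {ω | S (m + n) ω - S m ω = v - d} * 8⁻¹ := by rw [← h8]; exact h
      rw [measureReal_def, h', ENNReal.toReal_mul, ← measureReal_def, ih]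
      simp
    · intro d _ d' _ hdd
      refine Set.disjoint_left.2 fun ω h1 h2 => hdd ?_
      exact h1.2.symm.trans h2.2

lemma measurableSet_firstReturn (hS : IsDiagonalWalk P S x) (k : ℕ) :
    MeasurableSet (firstReturn S k) := by
  have h : ∀ i, MeasurableSet {ω | S i ω - S 0 ω = 0} := fun i =>
    ((hS.measurable _).sub (hS.measurable _)) (measurableSet_singleton 0)
  have h' : firstReturn S k =
      (⋂ i, ⋂ (_ : 1 ≤ i), ⋂ (_ : i < k + 1), {ω | S i ω - S 0 ω = 0}ᶜ) ∩
        {ω | S (k + 1) ω - S 0 ω = 0} := by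
    ext ω
    simp [firstReturn]
  rw [h']
  exact (MeasurableSet.iInter fun i => MeasurableSet.iInter fun _ => MeasurableSet.iInter
    fun _ => (h i).compl).inter (h _)

lemma measureReal_firstReturn_inter [IsProbabilityMeasure P] (hS : IsDiagonalWalk P S x)
    (k j : ℕ) :
    P.real (firstReturn S k ∩ {ω | S (k + 1 + j) ω - S (k + 1) ω = 0}) =
      P.real (firstReturn S k) * simpleWalkProb j 0 ^ 3 := by
  have hind := hS.indep.indepFun_finset (Finset.range (k + 1)) (Finset.Ico (k + 1) (k + 1 + j))
    (by
      refine Finset.disjoint_left.2 fun i h1 h2 => ?_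
      simp at h1 h2
      omega) hS.measurable_step
  set F : Ω → (Finset.range (k + 1) → Fin 3 → ℤ) := fun ω i => S (i + 1) ω - S i ω with hF
  set G : Ω → (Finset.Ico (k + 1) (k + 1 + j) → Fin 3 → ℤ) := fun ω i => S (i + 1) ω - S i ω with hG
  -- The event is determined by the first k + 1 steps, so it is the preimage of its own image. That
  -- image is measurable because the space of step sequences is countable and discrete.
  have hFE : F ⁻¹' (F '' firstReturn S k) = firstReturn S k := by
    refine Set.Subset.antisymm ?_ (Set.subset_preimage_image _ _)
    rintro ω ⟨ω', hω', he⟩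
    have hT : ∀ i, i ≤ k + 1 → S i ω' - S 0 ω' = S i ω - S 0 ω := by
      intro i hi
      rw [← zero_add i, ← sum_Ico_walk_steps S 0 i, ← sum_Ico_walk_steps S 0 i]
      refine Finset.sum_congr rfl fun l hl => ?_
      simp at hl
      exact congrFun he ⟨l, by simp; omega⟩
    exact ⟨fun i h1 h2 => hT i (by omega) ▸ hω'.1 i h1 h2, hT (k + 1) le_rfl ▸ hω'.2⟩
  have hGE : G ⁻¹' {g | ∑ i, g i = 0} = {ω | S (k + 1 + j) ω - S (k + 1) ω = 0} := by
    ext ω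
    have : ∑ i, G ω i = S (k + 1 + j) ω - S (k + 1) ω := by
      rw [← sum_Ico_walk_steps, ← Finset.sum_coe_sort
        (Finset.Ico (k + 1) (k + 1 + j)) fun i => S (i + 1) ω - S i ω]
    simp only [Set.mem_preimage, Set.mem_ofPred_eq, this]
  have h := hind.measure_inter_preimage_eq_mul (F '' firstReturn S k) {g | ∑ i, g i = 0}
    (MeasurableSet.of_discrete) (MeasurableSet.of_discrete)
  rw [hFE, hGE] at h
  have hinc := hS.measureReal_increment (k + 1) j 0
  simp only [Pi.zero_apply, Finset.prod_const, Finset.card_univ, Fintype.card_fin] at hinc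
  rw [measureReal_def, h, ENNReal.toReal_mul, ← measureReal_def, ← measureReal_def, hinc]

/-- The renewal equation. -/
lemma simpleWalkProb_cube_succ [IsProbabilityMeasure P] (hS : IsDiagonalWalk P S x) (n : ℕ) :
    simpleWalkProb (n + 1) 0 ^ 3 = ∑ p ∈ Finset.HasAntidiagonal.antidiagonal n,
      P.real (firstReturn S p.1) * simpleWalkProb p.2 0 ^ 3 := by
  have hinc := hS.measureReal_increment 0 (n + 1) 0
  simp only [Pi.zero_apply, Finset.prod_const, Finset.card_univ, Fintype.card_fin,
    zero_add] at hinc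
  have hset : {ω | S (n + 1) ω - S 0 ω = 0} = ⋃ p ∈ Finset.HasAntidiagonal.antidiagonal n,
      (firstReturn S p.1 ∩ {ω | S (p.1 + 1 + p.2) ω - S (p.1 + 1) ω = 0} : Set Ω) := by
    ext ω
    simp only [Set.mem_iUnion, Set.mem_inter_iff, Set.mem_ofPred_eq, exists_prop]
    constructor
    · intro h
      obtain ⟨k, hk, hω⟩ := exists_le_mem_firstReturn h
      refine ⟨(k, n - k), by simp; omega, hω, ?_⟩
      have h2 := hω.2
      simp only
      rw [show k + 1 + (n - k) = n + 1 by omega, ← sub_sub_sub_cancel_right _ _ (S 0 ω), h, h2,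
        sub_zero]
    · rintro ⟨⟨k, l⟩, hp, hω, h⟩
      simp only [Finset.HasAntidiagonal.mem_antidiagonal] at hp hω h
      subst hp
      rw [show k + l + 1 = k + 1 + l by omega, ← sub_add_sub_cancel _ (S (k + 1) ω), h, hω.2,
        add_zero]
  rw [← hinc, hset, measureReal_biUnion_finset]
  · exact Finset.sum_congr rfl fun p _ => hS.measureReal_firstReturn_inter _ _
  · rintro ⟨a, b⟩ hp ⟨c, d⟩ hq hpq
    have hac : a ≠ c := by
      rintro rfl
      simp at hp hq
      apply hpq
      simp
      omega
    exact ((pairwise_disjoint_firstReturn S hac).mono Set.inter_subset_left Set.inter_subset_left)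
  · exact fun p _ => (hS.measurableSet_firstReturn _).inter
      (((hS.measurable _).sub (hS.measurable _)) (measurableSet_singleton 0))

lemma hasSum_firstReturn [IsProbabilityMeasure P] (hS : IsDiagonalWalk P S x) :
    HasSum (fun k => P.real (firstReturn S k)) (returnProbability P S x) := by
  have hae : {ω | ∃ n : ℕ, 1 ≤ n ∧ S n ω = x} =ᵐ[P] ⋃ k, firstReturn S k := by
    filter_upwards [hS.start] with ω hω
    apply propext
    change (∃ n : ℕ, 1 ≤ n ∧ S n ω = x) ↔ ω ∈ ⋃ k, firstReturn S k
    rw [Set.mem_iUnion]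
    constructor
    · rintro ⟨n, hn, h⟩
      obtain ⟨n, rfl⟩ := Nat.exists_eq_add_of_le' hn
      obtain ⟨k, -, hk⟩ := exists_le_mem_firstReturn (S := S) (n := n) (ω := ω)
        (by rw [h, hω, sub_self])
      exact ⟨k, hk⟩
    · rintro ⟨k, hk⟩
      exact ⟨k + 1, by omega, by rw [← hω]; exact sub_eq_zero.1 hk.2⟩
  have hU := measure_iUnion (μ := P) (pairwise_disjoint_firstReturn S) hS.measurableSet_firstReturn
  have hfin : ∑' k, P (firstReturn S k) ≠ ⊤ := hU ▸ measure_ne_top _ _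
  rw [returnProbability, measureReal_congr hae, measureReal_def, hU,
    ENNReal.tsum_toReal_eq (ENNReal.ne_top_of_tsum_ne_top hfin)]
  exact ENNReal.hasSum_toReal hfin

lemma returnProbability_eq [IsProbabilityMeasure P] (hS : IsDiagonalWalk P S x) :
    returnProbability P S x = 1 - 1 / ∑' n, evenReturn n ^ 3 := by
  have hf := hS.hasSum_firstReturn
  have hu := hasSum_simpleWalkProb_cube
  have h0 : ∀ n, 0 ≤ simpleWalkProb n 0 ^ 3 := fun n => by
    have h := hS.measureReal_increment 0 n 0
    simp only [Pi.zero_apply, Finset.prod_const, Finset.card_univ, Fintype.card_fin] at h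
    rw [← h]
    exact measureReal_nonneg
  -- By the renewal equation the Cauchy product of the two series is the return series without its
  -- term 1 at time 0, so R G = G - 1.
  have hprod := tsum_mul_tsum_eq_tsum_sum_antidiagonal_of_summable_norm
    (hf.summable.norm) (hu.summable.norm)
  simp only [← hS.simpleWalkProb_cube_succ] at hprod
  rw [hf.tsum_eq, hu.tsum_eq] at hprod
  have hsplit := hu.summable.tsum_eq_zero_add
  rw [← hprod, hu.tsum_eq] at hsplit
  simp only [simpleWalkProb, if_true, one_pow] at hsplit
  have hpos : (∑' n, evenReturn n ^ 3) ≠ 0 := by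
    have := lt_tsum_evenReturn_cube
    intro h
    norm_num [h] at this
  field_simp
  linarith

lemma expectedDepartures_eq [IsProbabilityMeasure P] (hS : IsDiagonalWalk P S x) :
    expectedDepartures P S x = ENNReal.ofReal (∑' n, evenReturn n ^ 3) := by
  have hterm : ∀ n, ∫⁻ ω, (if S n ω = x then 1 else 0) ∂P =
      ENNReal.ofReal (simpleWalkProb n 0 ^ 3) := by
    intro n
    have hm : MeasurableSet {ω | S n ω = x} := hS.measurable n (measurableSet_singleton x)
    have hae : {ω | S n ω = x} =ᵐ[P] {ω | S (0 + n) ω - S 0 ω = 0} := by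
      filter_upwards [hS.start] with ω hω
      apply propext
      change S n ω = x ↔ S (0 + n) ω - S 0 ω = 0
      rw [zero_add, hω, sub_eq_zero]
    have h := hS.measureReal_increment 0 n 0
    simp only [Pi.zero_apply, Finset.prod_const, Finset.card_univ, Fintype.card_fin] at h
    rw [← h, ofReal_measureReal, ← measure_congr hae, ← lintegral_indicator_one hm]
    congr with ω
    simp [Set.indicator]
  have hm : ∀ n, Measurable fun ω => if S n ω = x then (1 : ENNReal) else 0 := fun n =>
    Measurable.ite (hS.measurable n (measurableSet_singleton x)) measurable_const measurable_const
  have h0 : ∀ n, 0 ≤ simpleWalkProb n 0 ^ 3 := fun n => by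
    have h := hS.measureReal_increment 0 n 0
    simp only [Pi.zero_apply, Finset.prod_const, Finset.card_univ, Fintype.card_fin] at h
    rw [← h]
    exact measureReal_nonneg
  rw [expectedDepartures, lintegral_tsum fun n => (hm n).aemeasurable]
  simp only [hterm]
  rw [← ENNReal.ofReal_tsum_of_nonneg h0 hasSum_simpleWalkProb_cube.summable,
    hasSum_simpleWalkProb_cube.tsum_eq]

end IsDiagonalWalk

theorem mainTheorem7 {Ω : Type*} [MeasurableSpace Ω] (P : Measure Ω) [IsProbabilityMeasure P]
    (S : ℕ → Ω → Fin 3 → ℤ) (x : Fin 3 → ℤ) (hS : IsDiagonalWalk P S x) :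
    (∃ θ : ℝ → ℝ → ℂ, IsAngleFunction θ) ∧
    ∀ θ : ℝ → ℝ → ℂ, IsAngleFunction θ →
      IntegrableOn (fun z : ℝ × ℝ => 1 / Complex.tanh (θ z.1 z.2))
        (Set.Ioo 0 Real.pi ×ˢ Set.Ioo 0 Real.pi) ∧
      ∃ F : ℝ, (F : ℂ) = diagonalIntegral θ ∧
        expectedDepartures P S x = ENNReal.ofReal F ∧
        returnProbability P S x = 1 - 1 / F ∧
        |F - 1.39| < 0.005 ∧ |(1 - 1 / F) - 0.28| < 0.005 := by
  refine ⟨exists_isAngleFunction, fun θ hθ => ⟨integrableOn_one_div_tanh hθ,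
    ∑' n, evenReturn n ^ 3, (diagonalIntegral_eq hθ).symm, hS.expectedDepartures_eq,
    hS.returnProbability_eq, ?_, ?_⟩⟩
  · have h1 := lt_tsum_evenReturn_cube
    have h2 := tsum_evenReturn_cube_lt
    rw [abs_lt]
    constructor <;> linarith
  · have h1 := lt_tsum_evenReturn_cube
    have h2 := tsum_evenReturn_cube_lt
    have h3 : (0 : ℝ) < ∑' n, evenReturn n ^ 3 := by linarith
    have h4 : 1 / ∑' n, evenReturn n ^ 3 < 0.725 := by
      rw [div_lt_iff₀ h3]
      linarith
    have h5 : 0.715 < 1 / ∑' n, evenReturn n ^ 3 := by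
      rw [lt_div_iff₀ h3]
      linarith
    rw [abs_lt]
    constructor <;> linarith
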